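/- Let $\mathbb H^3$ be three-dimensional hyperbolic space (constant sectional curvature $-1$) with Riemannian distance $d$. There exist absolute constants $C_1, C_2 > 0$ and $T_0$ such that the following holds for every $T \ge T_0$. Let $\gamma,\eta:[0,1]\to\mathbb H^3$ be unit speed geodesic segments and set $\phi(r,s)=d(\gamma(s),\eta(r))$ for $(r,s)\in[0,1]^2$. Let $(r_0,s_0)\in[0,\tfrac14]^2$ and $\rho_0=d(\gamma(s_0),\eta(r_0))$, and suppose that $$|\partial_r\phi(r_0,s_0)|\ge e^{-4T},\qquad 3\le\rho_0\le T,\qquad \angle\big(\nabla_1 d(\gamma(s_0),\eta(r_0)),\pm\dot\gamma(s_0)\big)\ge e^{-T}\ \text{ for both choices of }\pm,$$ where $\nabla_1 d(p,q)$ denotes the Riemannian gradient at $p$ of the function $d(\cdot,q)$. Then $$|\partial^3_{rss}\phi(r_0,s_0)|\ge e^{-C_1T}\quad\text{whenever}\quad |\partial^2_{rs}\phi(r_0,s_0)|\le e^{-C_2T}.$$ (Derivatives at boundary points of $[0,1]$ are one-sided.) -/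

import Mathlib

open Set

noncomputable section

namespace Hyp3

/-- The ambient space `ℝ^{1,3}` of the hyperboloid model of hyperbolic 3-space. -/
abbrev Ambient : Type := ℝ × EuclideanSpace ℝ (Fin 3)

/-- The Lorentzian form `⟨x, y⟩ = x₁y₁ + x₂y₂ + x₃y₃ - x₀y₀`. -/
def form (x y : Ambient) : ℝ := inner ℝ x.2 y.2 - x.1 * y.1

/-- Three-dimensional hyperbolic space (curvature `-1`): the upper sheet `⟨x, x⟩ = -1`, `x₀ > 0`. -/
def space : Set Ambient := {x | form x x = -1 ∧ 0 < x.1}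

/-- The tangent space of hyperbolic space at `p`. The restriction of `form` to it is
the Riemannian metric. -/
def tangentSpace (p : Ambient) : Set Ambient := {v | form p v = 0}

/-- The Riemannian length of a tangent vector. -/
def tnorm (v : Ambient) : ℝ := Real.sqrt (form v v)

/-- The angle, in `[0, π]`, between two nonzero vectors of the same tangent space. -/
def angle (v w : Ambient) : ℝ := Real.arccos (form v w / (tnorm v * tnorm w))

/-- The velocity of a curve parametrized by `[0, 1]` (one-sided at the endpoints). -/
def velocity (c : ℝ → Ambient) (t : ℝ) : Ambient := derivWithin c (Icc 0 1) t

/-- The orthogonal projection of the ambient space onto the tangent space at `p`. -/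
def tangentProj (p v : Ambient) : Ambient := v + form v p • p

/-- The covariant derivative (Levi-Civita connection of hyperbolic space) along the curve `c` of a
vector field `X` along `c`: the tangential part of the ambient derivative. -/
def covDeriv (c X : ℝ → Ambient) (t : ℝ) : Ambient :=
  tangentProj (c t) (derivWithin X (Icc 0 1) t)

/-- `c` restricted to `[0, 1]` is a `C¹` path in hyperbolic space from `x` to `y`. -/
structure IsPath (c : ℝ → Ambient) (x y : Ambient) : Prop where
  contDiffOn : ContDiffOn ℝ 1 c (Icc 0 1)
  mem : ∀ t ∈ Icc (0 : ℝ) 1, c t ∈ space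
  source : c 0 = x
  target : c 1 = y

/-- The Riemannian length of a path. -/
def pathLength (c : ℝ → Ambient) : ℝ := ∫ t in (0 : ℝ)..1, tnorm (velocity c t)

/-- The Riemannian distance on hyperbolic space: the infimum of the lengths of paths. -/
def rdist (x y : Ambient) : ℝ := sInf {L : ℝ | ∃ c : ℝ → Ambient, IsPath c x y ∧ L = pathLength c}

/-- `γ` restricted to `[0, 1]` is a unit speed geodesic segment of hyperbolic space. Values of `γ`
outside `[0, 1]` play no role. -/
structure IsUnitSpeedGeodesic (γ : ℝ → Ambient) : Prop where
  contDiffOn : ContDiffOn ℝ (⊤ : ℕ∞) γ (Icc 0 1)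
  mem : ∀ s ∈ Icc (0 : ℝ) 1, γ s ∈ space
  unit_speed : ∀ s ∈ Icc (0 : ℝ) 1, tnorm (velocity γ s) = 1
  geodesic : ∀ s ∈ Icc (0 : ℝ) 1, covDeriv γ (velocity γ) s = 0

/-- `w` is the Riemannian gradient at `p` of the function `f` on hyperbolic space: `w` is tangent
at `p` and `f` has derivative `⟨w, v⟩` along each curve through `p` with velocity `v`. -/
def HasRiemGradientAt (f : Ambient → ℝ) (w p : Ambient) : Prop :=
  w ∈ tangentSpace p ∧
    ∀ (c : ℝ → Ambient) (v : Ambient), (∀ t, c t ∈ space) → c 0 = p → HasDerivAt c v 0 →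
      HasDerivAt (fun t => f (c t)) (form w v) 0

/-- Partial derivative in the first variable `r` on the square `[0, 1]²`. -/
def partialR (f : ℝ → ℝ → ℝ) (r s : ℝ) : ℝ := derivWithin (fun r' => f r' s) (Icc 0 1) r

/-- Partial derivative in the second variable `s` on the square `[0, 1]²`. -/
def partialS (f : ℝ → ℝ → ℝ) (r s : ℝ) : ℝ := derivWithin (fun s' => f r s') (Icc 0 1) s

/-- The phase function `φ(r, s) = d(γ(s), η(r))`. -/
def phase (γ η : ℝ → Ambient) (r s : ℝ) : ℝ := rdist (γ s) (η r)

end Hyp3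

end

namespace Hyp3

/-! In the hyperboloid model `cosh d(x, y) = -form x y`, and a unit speed geodesic satisfies γ'' =
γ. So along γ the function A = cosh φ and its r-derivative B both solve f'' = f. Writing R = √(A² -
1) = sinh φ, one has φ_r = B/R and φ_s = A'/R, and differentiating φ_r twice in s gives φ_rss = -φ_r
(1 - φ_s²) / sinh² φ - 2 coth φ · φ_s · φ_rs. The hypotheses keep the first term away from zero:
|φ_r| ≥ e^{-4T}, sinh² φ ≤ e^{2T}, and, as φ_s pairs the gradient with γ', the angle condition gives
1 - φ_s² ≥ sin²(e^{-T}). The second term is small together with φ_rs.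

The geometric input is `rdist_eq_arcosh`, `IsUnitSpeedGeodesic.hasDerivWithinAt_velocity` and
`HasRiemGradientAt.form_eq`; the identity is `hasDerivWithinAt_deriv_div_sqrt`, and the estimate is
`lower_bound_of_estimates`. -/

theorem form_comm (x y : Ambient) : form x y = form y x := by
  simp only [form, real_inner_comm, mul_comm]

theorem form_add_left (x y z : Ambient) : form (x + y) z = form x z + form y z := by
  simp only [form, Prod.fst_add, Prod.snd_add, inner_add_left]; ring

theorem form_smul_left (a : ℝ) (x z : Ambient) : form (a • x) z = a * form x z := by
  simp only [form, Prod.smul_fst, Prod.smul_snd, real_inner_smul_left, smul_eq_mul]; ring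

theorem form_add_right (x y z : Ambient) : form x (y + z) = form x y + form x z := by
  rw [form_comm, form_add_left, form_comm y, form_comm z]

theorem form_smul_right (a : ℝ) (x z : Ambient) : form x (a • z) = a * form x z := by
  rw [form_comm, form_smul_left, form_comm]

theorem form_neg_right (x z : Ambient) : form x (-z) = -form x z := by
  rw [← neg_one_smul ℝ z, form_smul_right]; ring

theorem form_neg_left (x z : Ambient) : form (-x) z = -form x z := by
  rw [form_comm, form_neg_right, form_comm]

theorem form_zero_right (x : Ambient) : form x 0 = 0 := by
  rw [← zero_smul ℝ (0 : Ambient), form_smul_right, zero_mul]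

theorem continuous_form : Continuous fun p : Ambient × Ambient => form p.1 p.2 := by
  unfold form; fun_prop

theorem hasDerivWithinAt_form {X Y : ℝ → Ambient} {X' Y' : Ambient} {s : Set ℝ} {t : ℝ}
    (hX : HasDerivWithinAt X X' s t) (hY : HasDerivWithinAt Y Y' s t) :
    HasDerivWithinAt (fun t => form (X t) (Y t)) (form X' (Y t) + form (X t) Y') s t := by
  have hX1 := (ContinuousLinearMap.fst ℝ ℝ (EuclideanSpace ℝ (Fin 3))).hasFDerivAt
    |>.comp_hasDerivWithinAt t hX
  have hX2 := (ContinuousLinearMap.snd ℝ ℝ (EuclideanSpace ℝ (Fin 3))).hasFDerivAt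
    |>.comp_hasDerivWithinAt t hX
  have hY1 := (ContinuousLinearMap.fst ℝ ℝ (EuclideanSpace ℝ (Fin 3))).hasFDerivAt
    |>.comp_hasDerivWithinAt t hY
  have hY2 := (ContinuousLinearMap.snd ℝ ℝ (EuclideanSpace ℝ (Fin 3))).hasFDerivAt
    |>.comp_hasDerivWithinAt t hY
  refine ((hX2.inner ℝ hY2).sub (hX1.mul hY1)).congr_deriv ?_
  simp only [form, Function.comp, ContinuousLinearMap.coe_fst', ContinuousLinearMap.coe_snd']
  ring

/-! ### The form on tangent spaces -/

theorem fst_sq_eq {x : Ambient} (hx : x ∈ space) : x.1 ^ 2 = ‖x.2‖ ^ 2 + 1 := by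
  have := hx.1
  rw [form, real_inner_self_eq_norm_sq] at this
  linarith

theorem norm_snd_lt_fst {x : Ambient} (hx : x ∈ space) : ‖x.2‖ < x.1 :=
  lt_of_pow_lt_pow_left₀ 2 hx.2.le (by rw [fst_sq_eq hx]; linarith)

theorem fst_sq_mul_le {p v : Ambient} (hv : v ∈ tangentSpace p) :
    p.1 ^ 2 * v.1 ^ 2 ≤ ‖p.2‖ ^ 2 * ‖v.2‖ ^ 2 := by
  have h : inner ℝ p.2 v.2 = p.1 * v.1 := by
    have : form p v = 0 := hv
    rw [form] at this; linarith
  rw [← mul_pow, ← mul_pow, ← h]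
  exact sq_le_sq.2 (by rw [abs_of_nonneg (by positivity : 0 ≤ ‖p.2‖ * ‖v.2‖)]
                       exact abs_real_inner_le_norm _ _)

/-- Quantitative positive definiteness of the metric: Euclidean Cauchy–Schwarz bounds the time
component of `v`, and `p.1 ^ 2 - ‖p.2‖ ^ 2 = 1` leaves a full `‖v.2‖ ^ 2`. -/
theorem norm_sq_le_form_self {p v : Ambient} (hp : p ∈ space) (hv : v ∈ tangentSpace p) :
    ‖v.2‖ ^ 2 ≤ p.1 ^ 2 * form v v := by
  have h := fst_sq_mul_le hv
  have h2 := fst_sq_eq hp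
  rw [form, real_inner_self_eq_norm_sq]
  nlinarith

theorem form_self_nonneg {p v : Ambient} (hp : p ∈ space) (hv : v ∈ tangentSpace p) :
    0 ≤ form v v := by
  have h := norm_sq_le_form_self hp hv
  have : 0 < p.1 ^ 2 := pow_pos hp.2 2
  by_contra! h3
  nlinarith [sq_nonneg ‖v.2‖]

theorem eq_zero_of_form_self {p v : Ambient} (hp : p ∈ space) (hv : v ∈ tangentSpace p)
    (h0 : form v v = 0) : v = 0 := by
  have h := norm_sq_le_form_self hp hv
  have h2 : ‖v.2‖ = 0 := by
    rw [h0, mul_zero] at h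
    exact pow_eq_zero_iff two_ne_zero |>.1 (le_antisymm h (sq_nonneg _))
  rw [form, real_inner_self_eq_norm_sq, h2] at h0
  exact Prod.ext (by simpa using h0) (norm_eq_zero.1 h2)

theorem tnorm_sq {p v : Ambient} (hp : p ∈ space) (hv : v ∈ tangentSpace p) :
    tnorm v ^ 2 = form v v := Real.sq_sqrt (form_self_nonneg hp hv)

theorem tangentSpace_add {p v w : Ambient} (hv : v ∈ tangentSpace p) (hw : w ∈ tangentSpace p) :
    v + w ∈ tangentSpace p := by
  have h1 : form p v = 0 := hv
  have h2 : form p w = 0 := hw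
  change form p (v + w) = 0
  rw [form_add_right, h1, h2, add_zero]

theorem tangentSpace_smul {p v : Ambient} (a : ℝ) (hv : v ∈ tangentSpace p) :
    a • v ∈ tangentSpace p := by
  have h1 : form p v = 0 := hv
  change form p (a • v) = 0
  rw [form_smul_right, h1, mul_zero]

/-- The Cauchy–Schwarz inequality on a tangent space. -/
theorem form_sq_le {p v w : Ambient} (hp : p ∈ space) (hv : v ∈ tangentSpace p)
    (hw : w ∈ tangentSpace p) : form v w ^ 2 ≤ form v v * form w w := by
  have key : ∀ t : ℝ, 0 ≤ form w w * (t * t) + 2 * form v w * t + form v v := fun t => by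
    have := form_self_nonneg hp (tangentSpace_add hv (tangentSpace_smul t hw))
    simp only [form_add_left, form_add_right, form_smul_left, form_smul_right,
      form_comm w v] at this
    linarith
  have := discrim_le_zero key
  rw [discrim] at this
  linarith

theorem abs_form_le {p v w : Ambient} (hp : p ∈ space) (hv : v ∈ tangentSpace p)
    (hw : w ∈ tangentSpace p) : |form v w| ≤ tnorm v * tnorm w := by
  refine abs_le_of_sq_le_sq ?_ (mul_nonneg (Real.sqrt_nonneg _) (Real.sqrt_nonneg _))
  rw [mul_pow, tnorm_sq hp hv, tnorm_sq hp hw]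
  exact form_sq_le hp hv hw

theorem tangentProj_mem {x : Ambient} (hx : x ∈ space) (y : Ambient) :
    tangentProj x y ∈ tangentSpace x := by
  change form x (y + form y x • x) = 0
  rw [form_add_right, form_smul_right, hx.1, form_comm y x]
  ring

theorem form_tangentProj_self {x y : Ambient} (hx : x ∈ space) (hy : y ∈ space) :
    form (tangentProj x y) (tangentProj x y) = form x y ^ 2 - 1 := by
  simp only [tangentProj, form_add_left, form_add_right, form_smul_left, form_smul_right, hx.1,
    hy.1, form_comm y x]
  ring

theorem form_tangentProj_right {x v : Ambient} (hv : v ∈ tangentSpace x) (y : Ambient) :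
    form v (tangentProj x y) = form v y := by
  have h1 : form x v = 0 := hv
  rw [tangentProj, form_add_right, form_smul_right, form_comm v x, h1, mul_zero, add_zero]

theorem one_le_neg_form {x y : Ambient} (hx : x ∈ space) (hy : y ∈ space) : 1 ≤ -form x y := by
  have h1 := form_self_nonneg hx (tangentProj_mem hx y)
  rw [form_tangentProj_self hx hy] at h1
  have h2 : form x y < 0 := by
    have := (abs_le.1 (abs_real_inner_le_norm x.2 y.2)).2
    have := mul_lt_mul'' (norm_snd_lt_fst hx) (norm_snd_lt_fst hy) (norm_nonneg _) (norm_nonneg _)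
    rw [form]; linarith
  nlinarith

theorem eq_of_form_eq {x y : Ambient} (hx : x ∈ space) (hy : y ∈ space) (h : form x y = -1) :
    x = y := by
  have h1 := form_tangentProj_self hx hy
  have h2 := eq_zero_of_form_self hx (tangentProj_mem hx y) (by rw [h1, h]; norm_num)
  rw [tangentProj, form_comm, h, neg_one_smul, ← sub_eq_add_neg, sub_eq_zero] at h2
  exact h2.symm

/-- Cauchy–Schwarz against the tangential part of `y` at `x`, which has length sinh d(x, y). This
says that the distance to `y` is 1-Lipschitz, infinitesimally. -/
theorem abs_form_le_sqrt_mul {x y v : Ambient} (hx : x ∈ space) (hy : y ∈ space)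
    (hv : v ∈ tangentSpace x) : |form v y| ≤ tnorm v * √(form x y ^ 2 - 1) := by
  have h := abs_form_le hx hv (tangentProj_mem hx y)
  rwa [form_tangentProj_right hv, tnorm.eq_1 (tangentProj x y), form_tangentProj_self hx hy] at h

theorem tnorm_smul {a : ℝ} (ha : 0 ≤ a) (v : Ambient) : tnorm (a • v) = a * tnorm v := by
  rw [tnorm, form_smul_left, form_smul_right, ← mul_assoc, Real.sqrt_mul (mul_nonneg ha ha),
    Real.sqrt_mul_self ha, tnorm]

/-! ### Geodesic lines -/

/-- The unit speed geodesic line through `x` with velocity `v`. -/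
noncomputable def geodesicLine (x v : Ambient) (t : ℝ) : Ambient :=
  Real.cosh t • x + Real.sinh t • v

theorem geodesicLine_mem {x v : Ambient} (hx : x ∈ space) (hv : v ∈ tangentSpace x)
    (h1 : form v v = 1) (t : ℝ) : geodesicLine x v t ∈ space := by
  have h0 : form x v = 0 := hv
  refine ⟨?_, ?_⟩
  · simp only [geodesicLine, form_add_left, form_add_right, form_smul_left, form_smul_right, hx.1,
      h0, form_comm v x, h1]
    nlinarith [Real.cosh_sq t]
  · have h2 : v.1 ^ 2 < x.1 ^ 2 := by
      have := fst_sq_mul_le hv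
      have h3 := fst_sq_eq hx
      rw [form, real_inner_self_eq_norm_sq] at h1
      nlinarith
    have h3 : |v.1| < x.1 := abs_lt_of_sq_lt_sq h2 hx.2.le
    have h4 : |Real.sinh t| < Real.cosh t :=
      abs_lt_of_sq_lt_sq (by rw [Real.cosh_sq]; linarith) (Real.cosh_pos t).le
    have h5 := mul_lt_mul'' h4 h3 (abs_nonneg _) (abs_nonneg _)
    rw [← abs_mul] at h5
    have := neg_abs_le (Real.sinh t * v.1)
    simp only [geodesicLine, Prod.fst_add, Prod.smul_fst, smul_eq_mul]
    linarith

theorem hasDerivAt_geodesicLine (x v : Ambient) (t : ℝ) :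
    HasDerivAt (geodesicLine x v) (Real.sinh t • x + Real.cosh t • v) t :=
  ((Real.hasDerivAt_cosh t).smul_const x).add ((Real.hasDerivAt_sinh t).smul_const v)

/-! ### The distance -/

theorem IsPath.hasDerivWithinAt {c : ℝ → Ambient} {x y : Ambient} (hc : IsPath c x y) {t : ℝ}
    (ht : t ∈ Icc (0 : ℝ) 1) : HasDerivWithinAt c (velocity c t) (Icc 0 1) t :=
  (hc.contDiffOn.differentiableOn one_ne_zero t ht).hasDerivWithinAt

theorem velocity_mem_tangentSpace {c : ℝ → Ambient} (hmem : ∀ t ∈ Icc (0 : ℝ) 1, c t ∈ space)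
    {t : ℝ} (ht : t ∈ Icc (0 : ℝ) 1) (hd : HasDerivWithinAt c (velocity c t) (Icc 0 1) t) :
    velocity c t ∈ tangentSpace (c t) := by
  have hu := uniqueDiffOn_Icc (zero_lt_one' ℝ) t ht
  have h1 := hasDerivWithinAt_form hd hd
  have h2 : HasDerivWithinAt (fun t => form (c t) (c t)) 0 (Icc 0 1) t :=
    (hasDerivWithinAt_const t _ (-1 : ℝ)).congr_of_mem (fun s hs => (hmem s hs).1) ht
  have h3 := hu.eq_deriv _ h1 h2
  rw [form_comm (velocity c t)] at h3
  change form (c t) (velocity c t) = 0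
  linarith

/-- The derivative of arcosh(-⟨c(t), x⟩) is at most the speed of `c`; integrate over [0, 1]. -/
theorem arcosh_le_pathLength {c : ℝ → Ambient} {x y : Ambient} (hc : IsPath c x y) :
    Real.arcosh (-form x y) ≤ pathLength c := by
  have h01 : (0 : ℝ) ∈ Icc (0 : ℝ) 1 := ⟨le_rfl, zero_le_one⟩
  have h11 : (1 : ℝ) ∈ Icc (0 : ℝ) 1 := ⟨zero_le_one, le_rfl⟩
  have hx : x ∈ space := hc.source ▸ hc.mem 0 h01
  have hy : y ∈ space := hc.target ▸ hc.mem 1 h11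
  set u : ℝ → ℝ := fun t => -form (c t) x with hu
  have hu1 : ∀ t ∈ Icc (0 : ℝ) 1, 1 ≤ u t := fun t ht => one_le_neg_form (hc.mem t ht) hx
  have hud : ∀ t ∈ Icc (0 : ℝ) 1, HasDerivWithinAt u (-form (velocity c t) x) (Icc 0 1) t := by
    intro t ht
    have := (hasDerivWithinAt_form (hc.hasDerivWithinAt ht) (hasDerivWithinAt_const t _ x)).neg
    rwa [form_zero_right, add_zero] at this
  have hvc : ContinuousOn (fun t => tnorm (velocity c t)) (Icc 0 1) := by
    have := hc.contDiffOn.continuousOn_derivWithin (uniqueDiffOn_Icc zero_lt_one) le_rfl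
    exact (continuous_form.comp_continuousOn (this.prodMk this)).sqrt
  -- The shift by ε avoids the point 1, where arcosh is not differentiable and which `u` attains at
  -- t = 0; ε tends to 0 below.
  have key : ∀ ε : ℝ, 0 < ε →
      Real.arcosh (u 1 + ε) - Real.arcosh (u 0 + ε) ≤ pathLength c := by
    intro ε hε
    have hd : ∀ t ∈ Icc (0 : ℝ) 1, HasDerivWithinAt (fun t => Real.arcosh (u t + ε))
        ((√((u t + ε) ^ 2 - 1))⁻¹ * (-form (velocity c t) x)) (Icc 0 1) t := fun t ht =>
      (Real.hasDerivAt_arcosh (by have := hu1 t ht; simp only [mem_Ioi]; linarith))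
        |>.comp_hasDerivWithinAt t ((hud t ht).add_const ε)
    refine intervalIntegral.sub_le_integral_of_hasDeriv_right_of_le zero_le_one
      (fun t ht => (hd t ht).continuousWithinAt)
      (fun t ht => ((hd t (Ioo_subset_Icc_self ht)).hasDerivAt
        (Icc_mem_nhds ht.1 ht.2)).hasDerivWithinAt)
      (hvc.integrableOn_Icc) ?_
    intro t ht
    have ht' := Ioo_subset_Icc_self ht
    have h1 := abs_form_le_sqrt_mul (hc.mem t ht') hx
      (velocity_mem_tangentSpace hc.mem ht' (hc.hasDerivWithinAt ht'))
    have h2 := hu1 t ht'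
    have h3 : √(form (c t) x ^ 2 - 1) ≤ √((u t + ε) ^ 2 - 1) := by
      apply Real.sqrt_le_sqrt
      have : form (c t) x = - u t := by simp [hu]
      rw [this]; nlinarith
    have h4 : 0 < √((u t + ε) ^ 2 - 1) := Real.sqrt_pos.2 (by nlinarith)
    rw [inv_mul_le_iff₀ h4, mul_comm]
    calc -form (velocity c t) x ≤ |form (velocity c t) x| := neg_le_abs _
      _ ≤ _ := h1.trans (mul_le_mul_of_nonneg_left h3 (Real.sqrt_nonneg _))
  have hlim : ∀ a : ℝ, 1 ≤ a → Filter.Tendsto (fun ε => Real.arcosh (a + ε)) (nhdsWithin 0 (Ioi 0))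
      (nhds (Real.arcosh a)) := by
    intro a ha
    refine (Real.continuousOn_arcosh a ha).tendsto.comp (tendsto_nhdsWithin_iff.2 ⟨?_, ?_⟩)
    · have : Filter.Tendsto (fun ε : ℝ => a + ε) (nhds 0) (nhds (a + 0)) :=
        (continuous_const.add continuous_id).tendsto 0
      rw [add_zero] at this
      exact this.mono_left nhdsWithin_le_nhds
    · filter_upwards [self_mem_nhdsWithin] with ε hε
      have : 0 < ε := hε
      simp only [mem_Ici]; linarith
  have hl := le_of_tendsto ((hlim _ (hu1 1 h11)).sub (hlim _ (hu1 0 h01)))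
    (by filter_upwards [self_mem_nhdsWithin] with ε hε using key ε hε)
  have e0 : u 0 = 1 := by simp only [hu]; rw [hc.source, hx.1]; norm_num
  have e1 : u 1 = -form x y := by simp only [hu]; rw [hc.target, form_comm]
  rwa [e0, e1, Real.arcosh_zero, sub_zero] at hl

theorem exists_path_length_eq {x y : Ambient} (hx : x ∈ space) (hy : y ∈ space) :
    ∃ c : ℝ → Ambient, IsPath c x y ∧ Real.arcosh (-form x y) = pathLength c := by
  rcases (one_le_neg_form hx hy).eq_or_lt with h | h
  · obtain rfl := eq_of_form_eq hx hy (by linarith)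
    refine ⟨fun _ => x, ⟨contDiffOn_const, fun _ _ => hx, rfl, rfl⟩, ?_⟩
    have : ∀ t, velocity (fun _ => x) t = 0 := fun t => by simp [velocity]
    simp [pathLength, this, tnorm, form_zero_right, hx.1]
  · set d := Real.arcosh (-form x y) with hd
    have hcosh : Real.cosh d = -form x y := Real.cosh_arcosh h.le
    have hd0 : 0 < d := Real.arcosh_pos h
    have hs0 : 0 < Real.sinh d := Real.sinh_pos_iff.2 hd0
    -- The unit vector at `x` pointing towards `y`; the minimizer is its geodesic run at constant
    -- speed `d`.
    set v := (Real.sinh d)⁻¹ • tangentProj x y with hv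
    have hvt : v ∈ tangentSpace x := tangentSpace_smul _ (tangentProj_mem hx y)
    have hv0 : form x v = 0 := hvt
    have hv1 : form v v = 1 := by
      rw [hv, form_smul_left, form_smul_right, form_tangentProj_self hx hy, ← neg_sq, ← hcosh,
        Real.cosh_sq]
      field_simp
      ring
    have hder : ∀ t, HasDerivAt (fun t => geodesicLine x v (d * t))
        (d • (Real.sinh (d * t) • x + Real.cosh (d * t) • v)) t := fun t => by
      have h1 : HasDerivAt (fun t => d * t) d t := by simpa using (hasDerivAt_id t).const_mul d
      exact (hasDerivAt_geodesicLine x v (d * t)).scomp t h1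
    have hvel : ∀ t ∈ Icc (0 : ℝ) 1, tnorm (velocity (fun t => geodesicLine x v (d * t)) t) = d := by
      intro t ht
      rw [velocity, (hder t).hasDerivWithinAt.derivWithin (uniqueDiffOn_Icc zero_lt_one t ht),
        tnorm_smul hd0.le, tnorm]
      have : form (Real.sinh (d * t) • x + Real.cosh (d * t) • v)
          (Real.sinh (d * t) • x + Real.cosh (d * t) • v) = 1 := by
        simp only [form_add_left, form_add_right, form_smul_left, form_smul_right, hx.1,
          hv0, form_comm v x, hv1]
        nlinarith [Real.cosh_sq (d * t)]
      rw [this, Real.sqrt_one, mul_one]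
    refine ⟨fun t => geodesicLine x v (d * t), ⟨?_, fun t _ => geodesicLine_mem hx hvt hv1 _,
      ?_, ?_⟩, ?_⟩
    · refine ContDiff.contDiffOn ?_
      unfold geodesicLine
      fun_prop
    · simp [geodesicLine]
    · simp only [geodesicLine, mul_one]
      rw [hv, smul_smul, mul_inv_cancel₀ hs0.ne', one_smul, hcosh, tangentProj, form_comm y x,
        neg_smul]
      abel
    · rw [pathLength, intervalIntegral.integral_congr (g := fun _ => d) (fun t ht => hvel t
        (by rwa [uIcc_of_le zero_le_one] at ht))]
      simp

theorem rdist_eq_arcosh {x y : Ambient} (hx : x ∈ space) (hy : y ∈ space) :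
    rdist x y = Real.arcosh (-form x y) := by
  obtain ⟨c, hc, hl⟩ := exists_path_length_eq hx hy
  refine IsLeast.csInf_eq ⟨⟨c, hc, hl⟩, ?_⟩
  rintro _ ⟨c', hc', rfl⟩
  exact arcosh_le_pathLength hc'

/-! ### Unit speed geodesics -/

theorem IsUnitSpeedGeodesic.hasDerivWithinAt {γ : ℝ → Ambient} (hγ : IsUnitSpeedGeodesic γ) {t : ℝ}
    (ht : t ∈ Icc (0 : ℝ) 1) : HasDerivWithinAt γ (velocity γ t) (Icc 0 1) t :=
  (hγ.contDiffOn.differentiableOn (by simp) t ht).hasDerivWithinAt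

theorem IsUnitSpeedGeodesic.velocity_mem {γ : ℝ → Ambient} (hγ : IsUnitSpeedGeodesic γ) {t : ℝ}
    (ht : t ∈ Icc (0 : ℝ) 1) : velocity γ t ∈ tangentSpace (γ t) :=
  velocity_mem_tangentSpace hγ.mem ht (hγ.hasDerivWithinAt ht)

theorem IsUnitSpeedGeodesic.form_velocity {γ : ℝ → Ambient} (hγ : IsUnitSpeedGeodesic γ) {t : ℝ}
    (ht : t ∈ Icc (0 : ℝ) 1) : form (velocity γ t) (velocity γ t) = 1 := by
  rw [← tnorm_sq (hγ.mem t ht) (hγ.velocity_mem ht), hγ.unit_speed t ht, one_pow]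

/-- The geodesic equation in the hyperboloid model. -/
theorem IsUnitSpeedGeodesic.hasDerivWithinAt_velocity {γ : ℝ → Ambient}
    (hγ : IsUnitSpeedGeodesic γ) {t : ℝ} (ht : t ∈ Icc (0 : ℝ) 1) :
    HasDerivWithinAt (velocity γ) (γ t) (Icc 0 1) t := by
  have hU := uniqueDiffOn_Icc (zero_lt_one' ℝ)
  have hc : ContDiffOn ℝ 1 (velocity γ) (Icc 0 1) :=
    hγ.contDiffOn.derivWithin hU (by rw [one_add_one_eq_two]; exact WithTop.coe_le_coe.2 le_top)
  have hd := (hc.differentiableOn one_ne_zero t ht).hasDerivWithinAt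
  -- Differentiating ⟨γ', γ⟩ = 0 gives ⟨γ'', γ⟩ = -1, so the vanishing tangential part of γ'' is γ''
  -- - γ.
  have h1 := hasDerivWithinAt_form hd (hγ.hasDerivWithinAt ht)
  have h2 : HasDerivWithinAt (fun t => form (velocity γ t) (γ t)) 0 (Icc 0 1) t :=
    (hasDerivWithinAt_const t _ (0 : ℝ)).congr_of_mem
      (fun s hs => by rw [form_comm]; exact hγ.velocity_mem hs) ht
  have h3 := (hU t ht).eq_deriv _ h1 h2
  rw [hγ.form_velocity ht] at h3
  have h4 := hγ.geodesic t ht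
  rw [covDeriv, tangentProj, show form (derivWithin (velocity γ) (Icc 0 1) t) (γ t) = -1 by linarith,
    neg_one_smul, ← sub_eq_add_neg, sub_eq_zero] at h4
  rwa [h4] at hd

/-! ### The gradient of the distance -/

theorem HasRiemGradientAt.form_eq {x y g v : Ambient} (hx : x ∈ space) (hy : y ∈ space)
    (hxy : 1 < -form x y) (hg : HasRiemGradientAt (fun p => rdist p y) g x)
    (hv : v ∈ tangentSpace x) (hv1 : form v v = 1) :
    form g v = -form v y / √(form x y ^ 2 - 1) := by
  have hl0 : geodesicLine x v 0 = x := by simp [geodesicLine]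
  have hd : HasDerivAt (geodesicLine x v) v 0 := by simpa using hasDerivAt_geodesicLine x v 0
  have h1 := hg.2 _ v (geodesicLine_mem hx hv hv1) hl0 hd
  have h2 : (fun t => rdist (geodesicLine x v t) y) =
      fun t => Real.arcosh (-form (geodesicLine x v t) y) :=
    funext fun t => rdist_eq_arcosh (geodesicLine_mem hx hv hv1 t) hy
  have h3 := (hasDerivWithinAt_form hd.hasDerivWithinAt
    (hasDerivWithinAt_const 0 univ y)).hasDerivAt Filter.univ_mem |>.neg
  have h4 := (Real.hasDerivAt_arcosh (x := -form (geodesicLine x v 0) y)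
    (by rw [hl0]; exact hxy)).comp 0 h3
  rw [h2] at h1
  rw [h1.unique h4, hl0, form_zero_right, neg_sq, add_zero]
  ring

/-- Pair `g` with its own direction. The upper bound alone suffices for turning angle bounds into
bounds on φ_s. -/
theorem HasRiemGradientAt.tnorm_le_one {x y g : Ambient} (hx : x ∈ space) (hy : y ∈ space)
    (hxy : 1 < -form x y) (hg : HasRiemGradientAt (fun p => rdist p y) g x) : tnorm g ≤ 1 := by
  rcases (Real.sqrt_nonneg (form g g)).eq_or_lt with h | h
  · rw [tnorm, ← h]; exact zero_le_one
  · change 0 < tnorm g at h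
    have hv := tangentSpace_smul (tnorm g)⁻¹ hg.1
    have hsq := tnorm_sq hx hg.1
    have hv1 : form ((tnorm g)⁻¹ • g) ((tnorm g)⁻¹ • g) = 1 := by
      rw [form_smul_left, form_smul_right, ← hsq]; field_simp
    have h1 := hg.form_eq hx hy hxy hv hv1
    have h2 : form g ((tnorm g)⁻¹ • g) = tnorm g := by
      rw [form_smul_right, ← hsq]; field_simp
    have h3 := abs_form_le_sqrt_mul hx hy hv
    rw [show tnorm ((tnorm g)⁻¹ • g) = 1 by rw [tnorm.eq_1 (_ • g), hv1, Real.sqrt_one],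
      one_mul] at h3
    have h4 : 0 < √(form x y ^ 2 - 1) := Real.sqrt_pos.2 (by nlinarith)
    rw [← h2, h1, div_le_one h4]
    exact (neg_le_abs _).trans h3

theorem form_le_cos_of_le_angle {p v w : Ambient} (hp : p ∈ space) (hv : v ∈ tangentSpace p)
    (hw : w ∈ tangentSpace p) {θ : ℝ} (hθ : 0 ≤ θ) (h : θ ≤ angle v w) :
    form v w ≤ Real.cos θ * (tnorm v * tnorm w) := by
  have h0 : 0 ≤ tnorm v * tnorm w := mul_nonneg (Real.sqrt_nonneg _) (Real.sqrt_nonneg _)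
  have h1 := abs_le.1 (abs_form_le hp hv hw)
  rcases h0.eq_or_lt with h2 | h2
  · rw [← h2, mul_zero]; linarith
  · rw [← div_le_iff₀ h2]
    have h3 := Real.cos_le_cos_of_nonneg_of_le_pi hθ (Real.arccos_le_pi _) h
    rwa [Real.cos_arccos (by rw [le_div_iff₀ h2]; linarith)
      (by rw [div_le_iff₀ h2]; linarith)] at h3

/-! ### Derivatives of the phase -/

section Calculus

variable {A A' B B' : ℝ → ℝ} {S : Set ℝ} {s : ℝ}

theorem hasDerivWithinAt_sqrt_sq_sub_one (hA : HasDerivWithinAt A (A' s) S s) (h1 : 1 < A s) :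
    HasDerivWithinAt (fun s => √(A s ^ 2 - 1)) (A s * A' s / √(A s ^ 2 - 1)) S s := by
  have hW : 0 < A s ^ 2 - 1 := by nlinarith
  refine (((hA.pow 2).sub_const 1).sqrt hW.ne').congr_deriv ?_
  have := Real.sqrt_pos.2 hW
  simp
  field_simp

theorem hasDerivWithinAt_div_sqrt (hA : HasDerivWithinAt A (A' s) S s)
    (hB : HasDerivWithinAt B (B' s) S s) (h1 : 1 < A s) :
    HasDerivWithinAt (fun s => B s / √(A s ^ 2 - 1))
      ((B' s * √(A s ^ 2 - 1) ^ 2 - B s * A s * A' s) / √(A s ^ 2 - 1) ^ 3) S s := by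
  have hR : 0 < √(A s ^ 2 - 1) := Real.sqrt_pos.2 (by nlinarith)
  refine (hB.div (hasDerivWithinAt_sqrt_sq_sub_one hA h1) hR.ne').congr_deriv ?_
  field_simp

/-- The formula for φ_rss, from A'' = A, B'' = B and R² = A² - 1. It is grouped so that φ_r = B/R,
φ_s = A'/R and φ_rs appear as blocks. -/
theorem hasDerivWithinAt_deriv_div_sqrt (hA : HasDerivWithinAt A (A' s) S s)
    (hA' : HasDerivWithinAt A' (A s) S s) (hB : HasDerivWithinAt B (B' s) S s)
    (hB' : HasDerivWithinAt B' (B s) S s) (h1 : 1 < A s) :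
    HasDerivWithinAt
      (fun s => (B' s * √(A s ^ 2 - 1) ^ 2 - B s * A s * A' s) / √(A s ^ 2 - 1) ^ 3)
      (-(B s / √(A s ^ 2 - 1) * (1 - (A' s / √(A s ^ 2 - 1)) ^ 2) / √(A s ^ 2 - 1) ^ 2)
        - 2 * (A s / √(A s ^ 2 - 1)) * (A' s / √(A s ^ 2 - 1)) *
          ((B' s * √(A s ^ 2 - 1) ^ 2 - B s * A s * A' s) / √(A s ^ 2 - 1) ^ 3)) S s := by
  have hR : 0 < √(A s ^ 2 - 1) := Real.sqrt_pos.2 (by nlinarith)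
  have hR2 : √(A s ^ 2 - 1) ^ 2 = A s ^ 2 - 1 := Real.sq_sqrt (by nlinarith)
  have hRd := hasDerivWithinAt_sqrt_sq_sub_one hA h1
  refine (((hB'.mul (hRd.pow 2)).sub ((hB.mul hA).mul hA')).div (hRd.pow 3)
    (pow_pos hR 3).ne').congr_deriv ?_
  simp only [Pi.mul_apply, Pi.pow_apply, Pi.sub_apply]
  generalize √(A s ^ 2 - 1) = R at *
  push_cast
  field_simp
  linear_combination (B s * R ^ 2 - B s * A' s ^ 2) * hR2

end Calculus

theorem partialR_phase {γ η : ℝ → Ambient} (hγ : IsUnitSpeedGeodesic γ)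
    (hη : IsUnitSpeedGeodesic η) {r s : ℝ} (hr : r ∈ Icc (0 : ℝ) 1) (hs : s ∈ Icc (0 : ℝ) 1)
    (h1 : 1 < -form (γ s) (η r)) :
    partialR (phase γ η) r s =
      -form (γ s) (velocity η r) / √((-form (γ s) (η r)) ^ 2 - 1) := by
  have hd := (hasDerivWithinAt_form (hasDerivWithinAt_const r (Icc 0 1) (γ s))
    (hη.hasDerivWithinAt hr)).neg
  have hd2 := ((Real.hasDerivAt_arcosh h1).comp_hasDerivWithinAt (h := fun r' => -form (γ s) (η r'))
    r hd).congr_of_mem (f₁ := fun r' => phase γ η r' s)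
    (fun r' hr' => rdist_eq_arcosh (hγ.mem s hs) (hη.mem r' hr')) hr
  rw [partialR, hd2.derivWithin (uniqueDiffOn_Icc zero_lt_one r hr), form_comm 0, form_zero_right,
    zero_add]
  ring

theorem lower_bound_of_estimates {T A A' G P R : ℝ} (hT : 3 ≤ T) (hA : 2 ≤ A) (hR0 : 0 < R)
    (hR2 : R ^ 2 = A ^ 2 - 1) (hAT : A ≤ Real.exp T) (hG : Real.exp (-4 * T) ≤ |G|)
    (hc : |A' / R| ≤ Real.cos (Real.exp (-T))) (hP : |P| ≤ Real.exp (-9 * T)) :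
    Real.exp (-9 * T) ≤
      |-(G * (1 - (A' / R) ^ 2) / R ^ 2) - 2 * (A / R) * (A' / R) * P| := by
  set z := A' / R
  have hx0 : 0 < Real.exp (-T) := Real.exp_pos _
  have hx1 : Real.exp (-T) ≤ 1 := Real.exp_le_one_iff.2 (by linarith)
  have hsin : Real.exp (-T) / 2 ≤ Real.sin (Real.exp (-T)) := by
    have := Real.sin_gt_sub_cube hx0
    nlinarith [pow_le_one₀ hx0.le hx1 (n := 2)]
  have hz1 : |z| ≤ 1 := hc.trans (Real.cos_le_one _)
  have hz2 : Real.exp (-2 * T) / 4 ≤ 1 - z ^ 2 := by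
    have h1 : z ^ 2 ≤ Real.cos (Real.exp (-T)) ^ 2 := by
      rw [← sq_abs z]; exact pow_le_pow_left₀ (abs_nonneg _) hc 2
    have h2 := Real.sin_sq_add_cos_sq (Real.exp (-T))
    have h3 : Real.exp (-2 * T) = Real.exp (-T) ^ 2 := by rw [← Real.exp_nat_mul]; ring_nf
    rw [h3]
    nlinarith
  have hRle : R ^ 2 ≤ Real.exp (2 * T) := by
    have h3 : Real.exp (2 * T) = Real.exp T ^ 2 := by rw [← Real.exp_nat_mul]; ring_nf
    rw [h3]; nlinarith
  have hAR : |A / R| ≤ 2 := by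
    rw [abs_of_nonneg (by positivity), div_le_iff₀ hR0]
    nlinarith
  -- The exponent 8 is 4 + 2 + 2, from `G`, from 1 - z² and from R².
  have hmain : Real.exp (-8 * T) / 4 ≤ |G * (1 - z ^ 2) / R ^ 2| := by
    have hnn : 0 ≤ 1 - z ^ 2 := (by positivity : (0:ℝ) ≤ Real.exp (-2 * T) / 4).trans hz2
    rw [abs_div, abs_mul, abs_of_nonneg hnn, abs_of_pos (pow_pos hR0 2),
      le_div_iff₀ (pow_pos hR0 2)]
    calc Real.exp (-8 * T) / 4 * R ^ 2 ≤ Real.exp (-8 * T) / 4 * Real.exp (2 * T) := by gcongr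
      _ = Real.exp (-4 * T) * (Real.exp (-2 * T) / 4) := by
        rw [div_mul_eq_mul_div, ← mul_div_assoc, ← Real.exp_add, ← Real.exp_add]; ring_nf
      _ ≤ |G| * (1 - z ^ 2) := by gcongr
  have herr : |2 * (A / R) * z * P| ≤ 4 * Real.exp (-9 * T) := by
    rw [abs_mul, abs_mul, abs_mul, abs_two]
    calc 2 * |A / R| * |z| * |P| ≤ 2 * 2 * 1 * Real.exp (-9 * T) := by gcongr
      _ = _ := by ring
  -- Since e³ > 20, the main term is at least 5e^{-9T}; the error takes at most 4e^{-9T} of it.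
  have h20 : 20 * Real.exp (-9 * T) ≤ Real.exp (-8 * T) := by
    have h1 : Real.exp (-8 * T) = Real.exp T * Real.exp (-9 * T) := by
      rw [← Real.exp_add]; ring_nf
    rw [h1]
    have h2 : Real.exp 1 ^ 3 ≤ Real.exp T := by
      rw [← Real.exp_nat_mul]; exact Real.exp_le_exp.2 (by push_cast; linarith)
    have h3 : (2.718 : ℝ) ^ 3 ≤ Real.exp 1 ^ 3 :=
      pow_le_pow_left₀ (by norm_num) (by linarith [Real.exp_one_gt_d9]) 3
    have h4 : (20 : ℝ) ≤ 2.718 ^ 3 := by norm_num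
    have := h4.trans (h3.trans h2)
    gcongr
  have := abs_sub_abs_le_abs_sub (-(G * (1 - z ^ 2) / R ^ 2)) (2 * (A / R) * z * P)
  rw [abs_neg] at this
  linarith

end Hyp3

theorem lemmaT :
    ∃ C₁ : ℝ, 0 < C₁ ∧ ∃ C₂ : ℝ, 0 < C₂ ∧ ∃ T₀ : ℝ, ∀ T : ℝ, T₀ ≤ T →
      ∀ γ η : ℝ → Hyp3.Ambient, Hyp3.IsUnitSpeedGeodesic γ → Hyp3.IsUnitSpeedGeodesic η →
      ∀ r₀ ∈ Set.Icc (0 : ℝ) (1 / 4), ∀ s₀ ∈ Set.Icc (0 : ℝ) (1 / 4),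
        Real.exp (-4 * T) ≤ |Hyp3.partialR (Hyp3.phase γ η) r₀ s₀| →
        3 ≤ Hyp3.rdist (γ s₀) (η r₀) →
        Hyp3.rdist (γ s₀) (η r₀) ≤ T →
        ∀ g : Hyp3.Ambient,
          Hyp3.HasRiemGradientAt (fun p => Hyp3.rdist p (η r₀)) g (γ s₀) →
          Real.exp (-T) ≤ Hyp3.angle g (Hyp3.velocity γ s₀) →
          Real.exp (-T) ≤ Hyp3.angle g (-Hyp3.velocity γ s₀) →
          |Hyp3.partialS (Hyp3.partialR (Hyp3.phase γ η)) r₀ s₀| ≤ Real.exp (-C₂ * T) →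
          Real.exp (-C₁ * T) ≤
            |Hyp3.partialS (Hyp3.partialS (Hyp3.partialR (Hyp3.phase γ η))) r₀ s₀| := by
  refine ⟨9, by norm_num, 9, by norm_num, 3, ?_⟩
  intro T hT γ η hγ hη r₀ hr₀ s₀ hs₀ hφr hρ3 hρT g hg hang1 hang2 hrs
  have hr : r₀ ∈ Icc (0 : ℝ) 1 := ⟨hr₀.1, hr₀.2.trans (by norm_num)⟩
  have hs : s₀ ∈ Icc (0 : ℝ) 1 := ⟨hs₀.1, hs₀.2.trans (by norm_num)⟩
  have hx := hγ.mem s₀ hs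
  have hy := hη.mem r₀ hr
  have hv := hγ.velocity_mem hs
  have hU := uniqueDiffOn_Icc (zero_lt_one' ℝ)
  set A : ℝ → ℝ := fun s => -Hyp3.form (γ s) (η r₀) with hAdef
  set A' : ℝ → ℝ := fun s => -Hyp3.form (Hyp3.velocity γ s) (η r₀) with hA'def
  set B : ℝ → ℝ := fun s => -Hyp3.form (γ s) (Hyp3.velocity η r₀) with hBdef
  set B' : ℝ → ℝ := fun s => -Hyp3.form (Hyp3.velocity γ s) (Hyp3.velocity η r₀) with hB'def
  have hpair : ∀ (w : Hyp3.Ambient) (X Y : ℝ → Hyp3.Ambient) (s : ℝ),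
      HasDerivWithinAt X (Y s) (Icc 0 1) s →
      HasDerivWithinAt (fun s => -Hyp3.form (X s) w) (-Hyp3.form (Y s) w) (Icc 0 1) s := by
    intro w X Y s h
    have := (Hyp3.hasDerivWithinAt_form h (hasDerivWithinAt_const s _ w)).neg
    rwa [Hyp3.form_zero_right, add_zero] at this
  have hA : ∀ s ∈ Icc (0 : ℝ) 1, HasDerivWithinAt A (A' s) (Icc 0 1) s := fun s h =>
    hpair _ γ (Hyp3.velocity γ) s (hγ.hasDerivWithinAt h)
  have hA' : ∀ s ∈ Icc (0 : ℝ) 1, HasDerivWithinAt A' (A s) (Icc 0 1) s := fun s h =>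
    hpair _ (Hyp3.velocity γ) γ s (hγ.hasDerivWithinAt_velocity h)
  have hB : ∀ s ∈ Icc (0 : ℝ) 1, HasDerivWithinAt B (B' s) (Icc 0 1) s := fun s h =>
    hpair _ γ (Hyp3.velocity γ) s (hγ.hasDerivWithinAt h)
  have hB' : ∀ s ∈ Icc (0 : ℝ) 1, HasDerivWithinAt B' (B s) (Icc 0 1) s := fun s h =>
    hpair _ (Hyp3.velocity γ) γ s (hγ.hasDerivWithinAt_velocity h)
  have hρ := Hyp3.rdist_eq_arcosh hx hy
  have hA1 : 1 ≤ A s₀ := Hyp3.one_le_neg_form hx hy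
  have hcosh : A s₀ = Real.cosh (Hyp3.rdist (γ s₀) (η r₀)) := by
    rw [hρ, Real.cosh_arcosh hA1]
  have hA2 : 2 ≤ A s₀ := by
    rw [hcosh, Real.cosh_eq]
    have := Real.add_one_le_exp (Hyp3.rdist (γ s₀) (η r₀))
    have := Real.exp_pos (-Hyp3.rdist (γ s₀) (η r₀))
    linarith
  have hAT : A s₀ ≤ Real.exp T := by
    rw [hcosh, Real.cosh_eq]
    have h1 := Real.exp_le_exp.2 hρT
    have h2 : Real.exp (-Hyp3.rdist (γ s₀) (η r₀)) ≤ Real.exp T :=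
      Real.exp_le_exp.2 (by linarith)
    linarith
  have hA1' : 1 < A s₀ := by linarith
  -- The closed formulas need A > 1, which persists near s within [0, 1]; this is enough to
  -- differentiate them again.
  have hnear : ∀ s ∈ Icc (0 : ℝ) 1, 1 < A s →
      ∀ᶠ t in nhdsWithin s (Icc 0 1), t ∈ Icc (0 : ℝ) 1 ∧ 1 < A t :=
    fun s hs h => Filter.Eventually.and self_mem_nhdsWithin
      ((hA s hs).continuousWithinAt.eventually_const_lt h)
  have hR : ∀ s ∈ Icc (0 : ℝ) 1, 1 < A s →
      Hyp3.partialR (Hyp3.phase γ η) r₀ s = B s / √(A s ^ 2 - 1) := fun s hs h =>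
    Hyp3.partialR_phase hγ hη hr hs h
  have hRS : ∀ s ∈ Icc (0 : ℝ) 1, 1 < A s →
      Hyp3.partialS (Hyp3.partialR (Hyp3.phase γ η)) r₀ s =
        (B' s * √(A s ^ 2 - 1) ^ 2 - B s * A s * A' s) / √(A s ^ 2 - 1) ^ 3 := fun s hs h => by
    refine HasDerivWithinAt.derivWithin ?_ (hU s hs)
    refine (Hyp3.hasDerivWithinAt_div_sqrt (hA s hs) (hB s hs) h).congr_of_eventuallyEq ?_
      (hR s hs h)
    filter_upwards [hnear s hs h] with t ht using hR t ht.1 ht.2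
  have hRSS := ((Hyp3.hasDerivWithinAt_deriv_div_sqrt (hA s₀ hs) (hA' s₀ hs) (hB s₀ hs) (hB' s₀ hs)
    hA1').congr_of_eventuallyEq (by
      filter_upwards [hnear s₀ hs hA1'] with t ht using hRS t ht.1 ht.2)
      (hRS s₀ hs hA1')).derivWithin (hU s₀ hs)
  have hgv : Hyp3.form g (Hyp3.velocity γ s₀) = A' s₀ / √(A s₀ ^ 2 - 1) := by
    rw [hg.form_eq hx hy hA1' hv (hγ.form_velocity hs)]
    simp only [hAdef, hA'def, neg_sq]
  have hcos : |A' s₀ / √(A s₀ ^ 2 - 1)| ≤ Real.cos (Real.exp (-T)) := by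
    have hθ := (Real.exp_pos (-T)).le
    -- Nonnegativity of the cosine allows the factor `tnorm g ≤ 1` to be dropped; the two angle
    -- conditions then bound φ_s from above and from below.
    have hcos0 : 0 ≤ Real.cos (Real.exp (-T)) := by
      refine Real.cos_nonneg_of_neg_pi_div_two_le_of_le (by linarith [Real.pi_pos]) ?_
      have : Real.exp (-T) ≤ 1 := Real.exp_le_one_iff.2 (by linarith)
      linarith [Real.pi_gt_three]
    have hn := hg.tnorm_le_one hx hy hA1'
    have h1 := Hyp3.form_le_cos_of_le_angle hx hg.1 hv hθ hang1
    have hnv : -Hyp3.velocity γ s₀ ∈ Hyp3.tangentSpace (γ s₀) := by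
      rw [← neg_one_smul ℝ]; exact Hyp3.tangentSpace_smul _ hv
    have h2 := Hyp3.form_le_cos_of_le_angle hx hg.1 hnv hθ hang2
    rw [Hyp3.tnorm.eq_1 (-_), Hyp3.form_neg_right, Hyp3.form_neg_right, Hyp3.form_neg_left, neg_neg,
      ← Hyp3.tnorm] at h2
    rw [hγ.unit_speed s₀ hs, mul_one] at h1 h2
    rw [← hgv]
    have h3 := mul_le_of_le_one_right hcos0 hn
    exact abs_le.2 ⟨by linarith, by linarith⟩
  rw [hR s₀ hs hA1'] at hφr
  rw [hRS s₀ hs hA1'] at hrs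
  rw [Hyp3.partialS, hRSS]
  exact Hyp3.lower_bound_of_estimates hT hA2 (Real.sqrt_pos.2 (by nlinarith))
    (Real.sq_sqrt (by nlinarith)) hAT hφr hcos hrs
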